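/- Let $p\ge 1$, let $\Sigma^\star\in\mathbb{R}^{p\times p}$ be symmetric positive definite, and let $\Theta^\star=(\Sigma^\star)^{-1}$. Let $\mathcal{S}$ be either $\mathcal{M}^p=\{\Theta \text{ symmetric positive definite}: \Theta_{ij}=\Theta_{ji}\le 0\ \forall i\ne j\}$ or $\mathcal{M}^p_D=\{\Theta\in\mathcal{M}^p:\Theta\mathbf{1}\ge 0\}$, and suppose $\Theta^\star\in\mathcal{S}$. Let $x^{(1)},\dots,x^{(n)}$ be independent $\mathcal{N}(0,\Sigma^\star)$ random vectors with sample covariance matrix $\widehat\Sigma=\frac1n\sum_{i=1}^n x^{(i)}(x^{(i)})^\top$. Put $$c_0=12\,\lambda_{\max}(\Theta^\star)^2,\qquad c_1=\big(80\max_i\Sigma^\star_{ii}\big)^2,\qquad \rho=\tfrac{2+\sqrt2}{4},\qquad \lambda=\sqrt{c_1\tau\log p/n}\quad\text{with }\tau>2 .$$ Assume: (1) $p_\lambda:[0,\infty)\to[0,\infty)$ is nonincreasing, $p_\lambda(0)=\lambda$, $p_\lambda(c_0\lambda)\ge\frac{\sqrt2}{2}\lambda$, and for some $\gamma>0$ one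 has $p_\lambda(x)=0$ for all $x\ge\gamma\lambda$; (2) $\Theta^\star$ has at most $s$ nonzero entries (diagonal entries included), every nonzero off-diagonal entry satisfies $|\Theta^\star_{ij}|\ge(c_0+\gamma)\lambda$, and there is $\delta>0$ with $\delta\le\lambda_{\min}(\Theta^\star)\le\lambda_{\max}(\Theta^\star)\le 1/\delta$; (3) $n\ge 8c_0c_1\tau s\log p$. Let $\widehat\Theta^{(0)}$ be a (possibly random) matrix whose off-diagonal entries are zero, and for $k\ge1$ let, almost surely, $\widehat\Theta^{(k)}$ be a minimizer over $\Theta\in\mathcal{S}$ of $$-\log\det\Theta+\operatorname{tr}(\Theta\widehat\Sigma)+\sum_{i\ne j}\lambda^{(k)}_{ij}|\Theta_{ij}|,$$ where $\lambda^{(1)}_{ij}=\lambda$ and $\lambda^{(k)}_{ij}=p_\lambda\big(|\widehat\Theta^{(k-1)}_{ij}|\big)$ for $k\ge2$ (existence of these minimizers is assumed). Then, with probability at least $1-4/p^{\tau-2}$, for all $k\ge0$ simultaneously, $$\big\|\widehat\Theta^{(k)}-\Theta^\star\big\|_F\le c\sqrt{s\log p/n}+\rho^k\big\|\widehat\Theta^{(0)}-\Theta^\star\big\|_F,\qquad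 c=2c_0\sqrt{2c_1\tau}.$$ -/

import Mathlib

open MeasureTheory ProbabilityTheory

attribute [local instance] Matrix.frobeniusNormedAddCommGroup

noncomputable section

namespace MTP2

/-- The set of symmetric positive definite `M`-matrices of size `p`.
(Over `ℝ`, `Matrix.PosDef` includes symmetry.) -/
def MMatrices (p : ℕ) : Set (Matrix (Fin p) (Fin p) ℝ) :=
  {A | A.PosDef ∧ ∀ i j, i ≠ j → A i j = A j i ∧ A i j ≤ 0}

/-- The set of diagonally dominant symmetric positive definite `M`-matrices of size `p`. -/
def DDMMatrices (p : ℕ) : Set (Matrix (Fin p) (Fin p) ℝ) :=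
  {A | A.PosDef ∧ (∀ i j, i ≠ j → A i j = A j i ∧ A i j ≤ 0) ∧
    ∀ i, 0 ≤ (A.mulVec (fun _ => 1)) i}

/-- The largest eigenvalue of a symmetric real matrix. -/
def lambdaMax {p : ℕ} (A : Matrix (Fin p) (Fin p) ℝ) : ℝ := sSup (spectrum ℝ A)

/-- The smallest eigenvalue of a symmetric real matrix. -/
def lambdaMin {p : ℕ} (A : Matrix (Fin p) (Fin p) ℝ) : ℝ := sInf (spectrum ℝ A)

/-- The constant `c₀ = 12 λ_max(Θ⋆)²`. -/
def c0 {p : ℕ} (Theta : Matrix (Fin p) (Fin p) ℝ) : ℝ := 12 * lambdaMax Theta ^ 2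

/-- The constant `c₁ = (80 max_i Σ⋆_ii)²`. -/
def c1 {p : ℕ} (Sigma : Matrix (Fin p) (Fin p) ℝ) : ℝ := (80 * ⨆ i, Sigma i i) ^ 2

/-- The sample covariance matrix `(1/n) ∑ x⁽ⁱ⁾ x⁽ⁱ⁾ᵀ` of zero-mean observations. -/
def sampleCov {n p : ℕ} (x : Fin n → EuclideanSpace ℝ (Fin p)) : Matrix (Fin p) (Fin p) ℝ :=
  (1 / (n : ℝ)) • ∑ i, Matrix.vecMulVec (fun a => x i a) (fun a => x i a)

/-- The objective of one stage: the Gaussian negative log-likelihood plus the weighted `ℓ₁` penalty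
on the off-diagonal entries. -/
def stageObjective {p : ℕ} (Shat : Matrix (Fin p) (Fin p) ℝ) (W : Fin p → Fin p → ℝ)
    (A : Matrix (Fin p) (Fin p) ℝ) : ℝ :=
  -Real.log A.det + (A * Shat).trace + ∑ i, ∑ j, if i = j then 0 else W i j * |A i j|

/-- `A` is a minimizer over `S` of the objective of one stage. -/
def IsStageSolution {p : ℕ} (S : Set (Matrix (Fin p) (Fin p) ℝ))
    (Shat : Matrix (Fin p) (Fin p) ℝ) (W : Fin p → Fin p → ℝ)
    (A : Matrix (Fin p) (Fin p) ℝ) : Prop :=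
  A ∈ S ∧ IsMinOn (stageObjective Shat W) S A

/-- `Theta 0, Theta 1, Theta 2, …` is a sequence generated by the adaptive multiple-stage method
with feasible set `S`, sample covariance `Shat`, regularization parameter `lam` and weight-updating
function `w`: the initial matrix has vanishing off-diagonal entries, the first stage uses the
constant weight `lam`, and stage `k + 1` uses the weights `w |Θ⁽ᵏ⁾_ij|`. -/
structure IsAdaptiveSequence {p : ℕ} (S : Set (Matrix (Fin p) (Fin p) ℝ))
    (Shat : Matrix (Fin p) (Fin p) ℝ) (lam : ℝ) (w : ℝ → ℝ)
    (Theta : ℕ → Matrix (Fin p) (Fin p) ℝ) : Prop where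
  initial : ∀ i j, i ≠ j → Theta 0 i j = 0
  first : IsStageSolution S Shat (fun _ _ => lam) (Theta 1)
  next : ∀ k, 1 ≤ k → IsStageSolution S Shat (fun i j => w |Theta k i j|) (Theta (k + 1))

/-- The conditions on the weight-updating function `w = p_lam : [0, ∞) → [0, ∞)`. -/
structure WeightAssumption {p : ℕ} (Theta : Matrix (Fin p) (Fin p) ℝ) (lam γ : ℝ)
    (w : ℝ → ℝ) : Prop where
  nonneg : ∀ x, 0 ≤ x → 0 ≤ w x
  antitone : AntitoneOn w (Set.Ici 0)
  at_zero : w 0 = lam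
  gamma_pos : 0 < γ
  eq_zero : ∀ x, γ * lam ≤ x → w x = 0
  lower : √2 / 2 * lam ≤ w (c0 Theta * lam)

/-- The conditions on the underlying precision matrix. -/
structure PrecisionAssumption {p : ℕ} (Theta : Matrix (Fin p) (Fin p) ℝ) (s : ℕ)
    (lam γ : ℝ) : Prop where
  sparse : {ij : Fin p × Fin p | Theta ij.1 ij.2 ≠ 0}.ncard ≤ s
  signal : ∀ i j, i ≠ j → Theta i j ≠ 0 → (c0 Theta + γ) * lam ≤ |Theta i j|
  bounded : ∃ δ : ℝ, 0 < δ ∧ δ ≤ lambdaMin Theta ∧ lambdaMin Theta ≤ lambdaMax Theta ∧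
    lambdaMax Theta ≤ 1 / δ

end MTP2

end

/-!
The argument separates a deterministic error bound from a concentration inequality.

*One stage.*  On the feasible set the off-diagonal entries are nonpositive, so the `ℓ₁` penalty is
linear there and every stage minimizes `-log det` plus a linear functional.  Let `D` be the
difference between the minimizer and `Theta`.  Comparing the minimizer with its midpoint with
`Theta` (`norm_sq_div_le_of_isStageSolution`) and using the curvature of `-log det`
(`norm_sq_le_trace`) bounds `‖D‖² / (L (2 L + ‖D‖))`, where `L` is the largest eigenvalue of
`Theta`, by the sum of `(noise + weight) * D` over all entries.  Off the support of `Theta` the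
entries of `D` are nonpositive, hence an entry whose weight exceeds the noise level does not
contribute at all.

*Several stages.*  In the first stage all weights are `lam`, and only the support contributes: the
error is at most `6 L² lam √s` (`norm_first_stage_le`).  Later an entry has an inadequate weight
only if the previous estimate is wrong there by more than `c₀ lam`, and the number of such entries
is controlled by the Frobenius norm of the previous error.  This gives the contraction of
`norm_next_stage_le` with factor `1 / 4`, so that the bound `6 L² lam √s` propagates to every stage
(`norm_adaptiveSequence_le`).  It is below the claimed rate without the help of the term `ρᵏ`.

*Concentration.*  By polarization, an entry of the sample covariance matrix is a difference of sums
of squares of independent Gaussian variables, whose moment generating function is explicit.  A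
Chernoff bound and a union bound over the `p²` entries (`measure_iUnion_sampleCov_le`) show that the
noise stays below `√2 / 2 * lam` with the required probability.
-/

namespace MTP2

open Matrix

/-! ### Positive definite matrices -/

open scoped MatrixOrder in
lemma exists_eq_conjTranspose_mul_self {ι : Type*} [Fintype ι] {A : Matrix ι ι ℝ}
    (hA : A.PosSemidef) : ∃ C : Matrix ι ι ℝ, A = Cᴴ * C := by
  classical
  exact CStarAlgebra.nonneg_iff_eq_star_mul_self.mp hA.nonneg

lemma trace_mul_nonneg_of_posSemidef {ι : Type*} [Fintype ι] {A B : Matrix ι ι ℝ}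
    (hA : A.PosSemidef) (hB : B.PosSemidef) : 0 ≤ (A * B).trace := by
  classical
  obtain ⟨C, rfl⟩ := exists_eq_conjTranspose_mul_self hA
  rw [Matrix.mul_assoc, Matrix.trace_mul_comm]
  exact (hB.mul_mul_conjTranspose_same C).trace_nonneg

lemma log_det_le_trace_sub_card {ι : Type*} [Fintype ι] [DecidableEq ι] {A : Matrix ι ι ℝ}
    (hA : A.PosDef) : Real.log A.det ≤ A.trace - Fintype.card ι := by
  rw [hA.isHermitian.det_eq_prod_eigenvalues, hA.isHermitian.trace_eq_sum_eigenvalues]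
  simp only [RCLike.ofReal_real_eq_id, id]
  rw [Real.log_prod (fun i _ => (hA.eigenvalues_pos i).ne')]
  calc ∑ i, Real.log (hA.isHermitian.eigenvalues i)
      ≤ ∑ i, (hA.isHermitian.eigenvalues i - 1) :=
        Finset.sum_le_sum fun i _ => Real.log_le_sub_one_of_pos (hA.eigenvalues_pos i)
    _ = _ := by simp

/-- The tangent inequality for the concave function `log det` at the positive definite matrix `A`. -/
lemma log_det_sub_log_det_le {ι : Type*} [Fintype ι] [DecidableEq ι] {A B : Matrix ι ι ℝ}
    (hA : A.PosDef) (hB : B.PosDef) :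
    Real.log B.det - Real.log A.det ≤ (A⁻¹ * (B - A)).trace := by
  obtain ⟨C, hC⟩ := exists_eq_conjTranspose_mul_self hA.inv.posSemidef
  have hdet : C.det * C.det = A.det⁻¹ := by
    have := congrArg Matrix.det hC
    rw [Matrix.det_mul, Matrix.det_conjTranspose, Matrix.det_nonsing_inv,
      Ring.inverse_eq_inv'] at this
    simpa using this.symm
  have hCu : IsUnit C := by
    rw [Matrix.isUnit_iff_isUnit_det, isUnit_iff_ne_zero]
    intro h
    rw [h, mul_zero] at hdet
    exact (inv_pos.2 hA.det_pos).ne hdet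
  have hpos : (C * B * Cᴴ).PosDef :=
    hB.mul_mul_conjTranspose_same (by
      rw [Matrix.vecMul_injective_iff_isUnit]; exact hCu)
  have h := log_det_le_trace_sub_card hpos
  have h1 : (C * B * Cᴴ).det = A.det⁻¹ * B.det := by
    rw [Matrix.det_mul, Matrix.det_mul, Matrix.det_conjTranspose, ← hdet]
    simp; ring
  have h2 : (C * B * Cᴴ).trace = (A⁻¹ * B).trace := by
    rw [Matrix.trace_mul_comm, ← Matrix.mul_assoc, ← hC]
  rw [h1, h2, Real.log_mul (inv_pos.2 hA.det_pos).ne' hB.det_pos.ne', Real.log_inv] at h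
  rw [Matrix.mul_sub, Matrix.nonsing_inv_mul _ ((Matrix.isUnit_iff_isUnit_det A).1 hA.isUnit),
    Matrix.trace_sub, Matrix.trace_one]
  linarith

/-- If `A ≤ m` in the Loewner order, then `m⁻¹ ≤ A⁻¹`; this follows from
`A⁻¹ - m⁻¹ = (1 - m⁻¹ A) A⁻¹ (1 - m⁻¹ A) + m⁻² (m - A)`. -/
lemma posSemidef_inv_sub {ι : Type*} [Fintype ι] [DecidableEq ι] {A : Matrix ι ι ℝ} {m : ℝ}
    (hA : A.PosDef) (hm : 0 < m) (h : (m • (1 : Matrix ι ι ℝ) - A).PosSemidef) :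
    (A⁻¹ - m⁻¹ • (1 : Matrix ι ι ℝ)).PosSemidef := by
  have hu := (Matrix.isUnit_iff_isUnit_det A).1 hA.isUnit
  have h1 := hA.inv.posSemidef.conjTranspose_mul_mul_same (1 - m⁻¹ • A)
  have h2 := h.smul (show 0 ≤ m⁻¹ ^ 2 by positivity)
  have hAH : (1 - m⁻¹ • A)ᴴ = 1 - m⁻¹ • A := by
    rw [conjTranspose_sub, conjTranspose_one, conjTranspose_smul, hA.isHermitian.eq, star_trivial]
  have hm2 : m⁻¹ * m⁻¹ * m = m⁻¹ := by field_simp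
  have heq : (1 - m⁻¹ • A) * A⁻¹ * (1 - m⁻¹ • A) + m⁻¹ ^ 2 • (m • (1 : Matrix ι ι ℝ) - A)
      = A⁻¹ - m⁻¹ • (1 : Matrix ι ι ℝ) := by
    simp only [sub_mul, mul_sub, one_mul, mul_one, smul_mul_assoc, mul_smul_comm,
      Matrix.mul_nonsing_inv _ hu, Matrix.nonsing_inv_mul _ hu, smul_sub, smul_smul, pow_two, hm2]
    abel
  rw [hAH] at h1
  exact heq ▸ h1.add h2

lemma frobenius_norm_sq {ι : Type*} [Fintype ι] (A : Matrix ι ι ℝ) :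
    ‖A‖ ^ 2 = ∑ i, ∑ j, A i j ^ 2 := by
  rw [Matrix.frobenius_norm_def, ← Real.sqrt_eq_rpow, Real.sq_sqrt (by positivity)]
  simp

lemma posSemidef_norm_smul_one_sub {ι : Type*} [Fintype ι] [DecidableEq ι] {A : Matrix ι ι ℝ}
    (hA : A.IsHermitian) : (‖A‖ • (1 : Matrix ι ι ℝ) - A).PosSemidef := by
  refine .of_dotProduct_mulVec_nonneg ?_ fun x => ?_
  · exact (isHermitian_one.smul (IsSelfAdjoint.all _)).sub hA
  · rw [star_trivial, Matrix.sub_mulVec, dotProduct_sub, Matrix.smul_mulVec, Matrix.one_mulVec,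
      dotProduct_smul, smul_eq_mul, sub_nonneg]
    have hx : 0 ≤ x ⬝ᵥ x := by simpa using dotProduct_star_self_nonneg x
    refine abs_le_of_sq_le_sq' ?_ (by positivity) |>.2
    have h1 : x ⬝ᵥ A *ᵥ x = ∑ q : ι × ι, A q.1 q.2 * (x q.1 * x q.2) := by
      simp only [dotProduct, mulVec, Fintype.sum_prod_type, Finset.mul_sum]
      refine Finset.sum_congr rfl fun i _ => Finset.sum_congr rfl fun j _ => by ring
    rw [h1]
    refine (Finset.sum_mul_sq_le_sq_mul_sq _ _ _).trans_eq ?_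
    rw [mul_pow, frobenius_norm_sq, Fintype.sum_prod_type, Fintype.sum_prod_type]
    congr 1
    simp only [dotProduct, pow_two, Finset.sum_mul_sum]
    refine Finset.sum_congr rfl fun i _ => Finset.sum_congr rfl fun j _ => by ring

lemma posSemidef_lambdaMax_smul_one_sub {p : ℕ} {A : Matrix (Fin p) (Fin p) ℝ}
    (hA : A.IsHermitian) :
    (lambdaMax A • (1 : Matrix (Fin p) (Fin p) ℝ) - A).PosSemidef := by
  refine posSemidef_iff_isHermitian_and_spectrum_nonneg.2
    ⟨(isHermitian_one.smul (IsSelfAdjoint.all _)).sub hA, ?_⟩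
  rw [← Algebra.algebraMap_eq_smul_one, ← spectrum.singleton_sub_eq]
  rintro _ ⟨_, rfl, y, hy, rfl⟩
  have hbdd : BddAbove (spectrum ℝ A) :=
    hA.spectrum_real_eq_range_eigenvalues ▸ (Set.finite_range _).bddAbove
  exact sub_nonneg.2 (le_csSup hbdd hy)

/-- A quantitative form of the strong convexity of `-log det`: the Loewner bounds `A ≤ l` and
`B ≤ m` give `A⁻¹ ≥ l⁻¹` and `B⁻¹ ≥ m⁻¹`. -/
lemma norm_sq_le_trace {ι : Type*} [Fintype ι] [DecidableEq ι] {A B D : Matrix ι ι ℝ} {l m : ℝ}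
    (hA : A.PosDef) (hB : B.PosDef) (hD : D.IsHermitian) (hl : 0 < l) (hm : 0 < m)
    (hAl : (l • (1 : Matrix ι ι ℝ) - A).PosSemidef)
    (hBm : (m • (1 : Matrix ι ι ℝ) - B).PosSemidef) :
    ‖D‖ ^ 2 / (l * m) ≤ (A⁻¹ * D * B⁻¹ * D).trace := by
  have hD' : Dᴴ = D := hD
  have h1 := trace_mul_nonneg_of_posSemidef (posSemidef_inv_sub hA hl hAl)
    (hB.inv.posSemidef.conjTranspose_mul_mul_same D)
  have h2 := ((posSemidef_inv_sub hB hm hBm).conjTranspose_mul_mul_same D).trace_nonneg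
  have h3 : (D * D).trace = ‖D‖ ^ 2 := by
    rw [frobenius_norm_sq]
    simp only [trace, diag, mul_apply, pow_two]
    refine Finset.sum_congr rfl fun i _ => Finset.sum_congr rfl fun j _ => ?_
    rw [← hD.apply i j]; simp
  simp only [hD', sub_mul, mul_sub, smul_mul_assoc, mul_smul_comm, one_mul, mul_one, trace_sub,
    trace_smul, smul_eq_mul, h3, ← Matrix.mul_assoc] at h1 h2
  have h4 : ‖D‖ ^ 2 / (l * m) = l⁻¹ * (m⁻¹ * ‖D‖ ^ 2) := by field_simp
  rw [h4]
  have := mul_le_mul_of_nonneg_left (sub_nonneg.1 h2) (inv_pos.2 hl).le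
  linarith

/-! ### The basic inequality of one stage -/

lemma midpoint_mem {p : ℕ} {S : Set (Matrix (Fin p) (Fin p) ℝ)}
    (hS : S = MMatrices p ∨ S = DDMMatrices p) {A B : Matrix (Fin p) (Fin p) ℝ}
    (hA : A ∈ S) (hB : B ∈ S) : (1 / 2 : ℝ) • (A + B) ∈ S := by
  have hoff : (∀ i j, i ≠ j → A i j = A j i ∧ A i j ≤ 0) →
      (∀ i j, i ≠ j → B i j = B j i ∧ B i j ≤ 0) → ∀ i j, i ≠ j →
        ((1 / 2 : ℝ) • (A + B)) i j = ((1 / 2 : ℝ) • (A + B)) j i ∧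
        ((1 / 2 : ℝ) • (A + B)) i j ≤ 0 := by
    intro h1 h2 i j hij
    have := h1 i j hij
    have := h2 i j hij
    simp only [Matrix.smul_apply, Matrix.add_apply, smul_eq_mul]
    constructor <;> linarith
  rcases hS with rfl | rfl
  · exact ⟨(hA.1.add hB.1).smul (by norm_num), hoff hA.2 hB.2⟩
  · refine ⟨(hA.1.add hB.1).smul (by norm_num), hoff hA.2.1 hB.2.1, fun i => ?_⟩
    have h1 := hA.2.2 i
    have h2 := hB.2.2 i
    rw [smul_mulVec, add_mulVec, Pi.smul_apply, Pi.add_apply, smul_eq_mul]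
    linarith

lemma posDef_of_mem {p : ℕ} {S : Set (Matrix (Fin p) (Fin p) ℝ)}
    (hS : S = MMatrices p ∨ S = DDMMatrices p) {A : Matrix (Fin p) (Fin p) ℝ}
    (hA : A ∈ S) : A.PosDef := by
  rcases hS with rfl | rfl <;> exact hA.1

lemma offDiag_nonpos_of_mem {p : ℕ} {S : Set (Matrix (Fin p) (Fin p) ℝ)}
    (hS : S = MMatrices p ∨ S = DDMMatrices p) {A : Matrix (Fin p) (Fin p) ℝ}
    (hA : A ∈ S) {i j : Fin p} (hij : i ≠ j) : A i j ≤ 0 := by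
  rcases hS with rfl | rfl
  · exact (hA.2 i j hij).2
  · exact (hA.2.1 i j hij).2

/-- On matrices with nonpositive off-diagonal entries the penalty is linear, so that the objective
of one stage is `-log det` plus a linear functional. -/
lemma stageObjective_eq {p : ℕ} {Shat : Matrix (Fin p) (Fin p) ℝ} {W : Fin p → Fin p → ℝ}
    {A : Matrix (Fin p) (Fin p) ℝ} (hA : ∀ i j, i ≠ j → A i j ≤ 0) :
    stageObjective Shat W A = -Real.log A.det +
      ∑ i, ∑ j, (Shat j i - if i = j then 0 else W i j) * A i j := by
  rw [stageObjective, add_assoc]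
  congr 1
  simp only [trace, diag, mul_apply, ← Finset.sum_add_distrib]
  refine Finset.sum_congr rfl fun i _ => Finset.sum_congr rfl fun j _ => ?_
  by_cases hij : i = j
  · simp [hij, mul_comm]
  · simp only [hij, if_false, abs_of_nonpos (hA i j hij)]
    ring

/-- The basic inequality of one stage.  Testing the minimality of `A` against the midpoint of `A`
and `Theta` keeps the comparison inside the feasible set and replaces the first order optimality
condition, at the price of a constant factor. -/
lemma norm_sq_div_le_of_isStageSolution {p : ℕ} {S : Set (Matrix (Fin p) (Fin p) ℝ)}
    (hS : S = MMatrices p ∨ S = DDMMatrices p) {Shat Theta A : Matrix (Fin p) (Fin p) ℝ}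
    {W : Fin p → Fin p → ℝ} (hTheta : Theta ∈ S) (hA : IsStageSolution S Shat W A)
    (hL : 0 < lambdaMax Theta) :
    ‖A - Theta‖ ^ 2 / (lambdaMax Theta * (2 * lambdaMax Theta + ‖A - Theta‖)) ≤
      ∑ i, ∑ j, ((Theta⁻¹ - Shat) j i + if i = j then 0 else W i j) * (A - Theta) i j := by
  obtain ⟨hAS, hmin⟩ := hA
  set M := (1 / 2 : ℝ) • (A + Theta) with hM
  set D := A - Theta with hD
  set L := lambdaMax Theta
  have hMS : M ∈ S := midpoint_mem hS hAS hTheta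
  have hMpos := posDef_of_mem hS hMS
  have hApos := posDef_of_mem hS hAS
  have hTpos := posDef_of_mem hS hTheta
  have hAM : A - M = (1 / 2 : ℝ) • D := by rw [hM, hD]; module
  have hMT : M - Theta = (1 / 2 : ℝ) • D := by rw [hM, hD]; module
  have hDH : D.IsHermitian := hApos.isHermitian.sub hTpos.isHermitian
  -- minimality against the midpoint
  have h1 : stageObjective Shat W A ≤ stageObjective Shat W M := hmin hMS
  rw [stageObjective_eq fun i j => offDiag_nonpos_of_mem hS hAS,
    stageObjective_eq fun i j => offDiag_nonpos_of_mem hS hMS] at h1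
  have h2 := log_det_sub_log_det_le hMpos hApos
  rw [hAM, mul_smul_comm, trace_smul, smul_eq_mul] at h2
  have h3 : ∑ i, ∑ j, (Shat j i - if i = j then 0 else W i j) * A i j -
      ∑ i, ∑ j, (Shat j i - if i = j then 0 else W i j) * M i j =
      1 / 2 * ∑ i, ∑ j, (Shat j i - if i = j then 0 else W i j) * D i j := by
    simp only [Finset.mul_sum, ← Finset.sum_sub_distrib]
    refine Finset.sum_congr rfl fun i _ => Finset.sum_congr rfl fun j _ => ?_
    have : A i j - M i j = 1 / 2 * D i j := congrFun₂ hAM i j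
    rw [← mul_sub, this]; ring
  -- strong convexity of `-log det` between `Theta` and the midpoint
  have hMbd : ((L + ‖D‖ / 2) • (1 : Matrix (Fin p) (Fin p) ℝ) - M).PosSemidef := by
    convert (posSemidef_lambdaMax_smul_one_sub hTpos.isHermitian).add
      ((posSemidef_norm_smul_one_sub hDH).smul (show (0 : ℝ) ≤ 1 / 2 by norm_num)) using 1
    rw [hM, hD]; module
  have h4 := norm_sq_le_trace hTpos hMpos hDH hL (by positivity)
    (posSemidef_lambdaMax_smul_one_sub hTpos.isHermitian) hMbd
  have hTu := (isUnit_iff_isUnit_det Theta).1 hTpos.isUnit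
  have hMu := (isUnit_iff_isUnit_det M).1 hMpos.isUnit
  have h5 : (Theta⁻¹ * D * M⁻¹ * D).trace = 2 * ((Theta⁻¹ * D).trace - (M⁻¹ * D).trace) := by
    have : Theta⁻¹ * D * M⁻¹ = (2 : ℝ) • (Theta⁻¹ - M⁻¹) := by
      have hD2 : D = (2 : ℝ) • (M - Theta) := by rw [hMT, smul_smul]; norm_num
      rw [hD2, mul_smul_comm, smul_mul_assoc, Matrix.mul_sub, Matrix.sub_mul, Matrix.mul_assoc,
        mul_nonsing_inv _ hMu, nonsing_inv_mul _ hTu, Matrix.mul_one, Matrix.one_mul]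
    rw [this, smul_mul_assoc, trace_smul, Matrix.sub_mul, trace_sub, smul_eq_mul]
  have h6 : ∑ i, ∑ j, ((Theta⁻¹ - Shat) j i + if i = j then 0 else W i j) * D i j =
      (Theta⁻¹ * D).trace - ∑ i, ∑ j, (Shat j i - if i = j then 0 else W i j) * D i j := by
    rw [trace_mul_comm]
    simp only [trace, diag, mul_apply, ← Finset.sum_sub_distrib]
    refine Finset.sum_congr rfl fun i _ => Finset.sum_congr rfl fun j _ => ?_
    rw [Matrix.sub_apply]; ring
  have h7 : ‖D‖ ^ 2 / (L * (2 * L + ‖D‖)) = 1 / 2 * (‖D‖ ^ 2 / (L * (L + ‖D‖ / 2))) := by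
    have : 0 < 2 * L + ‖D‖ := by positivity
    have : 0 < L + ‖D‖ / 2 := by positivity
    field_simp
  rw [h6, h7]
  linarith

lemma sum_abs_le_sqrt_card_mul_norm {ι : Type*} [Fintype ι] (D : Matrix ι ι ℝ)
    (F : Finset (ι × ι)) : ∑ q ∈ F, |D q.1 q.2| ≤ √F.card * ‖D‖ := by
  refine abs_le_of_sq_le_sq' ?_ (by positivity) |>.2
  rw [mul_pow, Real.sq_sqrt (by positivity), frobenius_norm_sq]
  refine sq_sum_le_card_mul_sum_sq.trans ?_
  gcongr
  rw [← Fintype.sum_prod_type' (f := fun i j => D i j ^ 2)]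
  simp only [sq_abs]
  exact Finset.sum_le_sum_of_subset_of_nonneg (Finset.subset_univ _) fun _ _ _ => sq_nonneg _

/-- If the linear term of the basic inequality is dominated entrywise by `lam |D|` on each of two
index sets `F` and `G`, the error is controlled by the square roots of the sizes of `F` and `G`. -/
lemma norm_sub_le_of_isStageSolution {p : ℕ} {S : Set (Matrix (Fin p) (Fin p) ℝ)}
    (hS : S = MMatrices p ∨ S = DDMMatrices p) {Shat Theta A : Matrix (Fin p) (Fin p) ℝ}
    {W : Fin p → Fin p → ℝ} (hTheta : Theta ∈ S) (hA : IsStageSolution S Shat W A)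
    (hL : 0 < lambdaMax Theta) {lam : ℝ} {F G : Finset (Fin p × Fin p)}
    (hFG : ∀ i j, ((Theta⁻¹ - Shat) j i + if i = j then 0 else W i j) * (A - Theta) i j ≤
      lam * (((if (i, j) ∈ F then 1 else 0) + if (i, j) ∈ G then 1 else 0) * |(A - Theta) i j|))
    (hlam : 0 ≤ lam) (hu : lambdaMax Theta * (lam * (√F.card + √G.card)) ≤ 1 / 3) :
    ‖A - Theta‖ ≤ lambdaMax Theta ∧
      ‖A - Theta‖ ≤ 3 * lambdaMax Theta ^ 2 * (lam * (√F.card + √G.card)) := by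
  have h := norm_sq_div_le_of_isStageSolution hS hTheta hA hL
  set D := A - Theta
  set L := lambdaMax Theta
  set u := lam * (√F.card + √G.card) with hu'
  have hx : 0 ≤ ‖D‖ := norm_nonneg _
  have hu0 : 0 ≤ u := by positivity
  have hsum : ‖D‖ ^ 2 / (L * (2 * L + ‖D‖)) ≤ u * ‖D‖ := by
    refine h.trans ((Finset.sum_le_sum fun i _ => Finset.sum_le_sum fun j _ => hFG i j).trans ?_)
    have hsplit : ∑ i, ∑ j, lam * (((if (i, j) ∈ F then 1 else 0) +
        if (i, j) ∈ G then 1 else 0) * |D i j|) =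
        lam * (∑ q ∈ F, |D q.1 q.2| + ∑ q ∈ G, |D q.1 q.2|) := by
      rw [← Fintype.sum_prod_type' (f := fun i j => lam * (((if (i, j) ∈ F then 1 else 0) +
        if (i, j) ∈ G then 1 else 0) * |D i j|)), ← Finset.mul_sum]
      simp [add_mul, Finset.sum_add_distrib, ite_mul]
    rw [hsplit, hu', mul_assoc, add_mul]
    exact mul_le_mul_of_nonneg_left (add_le_add (sum_abs_le_sqrt_card_mul_norm D F)
      (sum_abs_le_sqrt_card_mul_norm D G)) hlam
  have hle : ‖D‖ ≤ (2 * L + ‖D‖) * (L * u) := by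
    rcases hx.eq_or_lt with h0 | hpos
    · rw [← h0]; positivity
    · rw [div_le_iff₀ (by positivity)] at hsum
      have : ‖D‖ * ‖D‖ ≤ ‖D‖ * ((2 * L + ‖D‖) * (L * u)) := by nlinarith
      exact le_of_mul_le_mul_left this hpos
  have hDL : ‖D‖ ≤ L := by nlinarith
  refine ⟨hDL, hle.trans ?_⟩
  have : (2 * L + ‖D‖) * (L * u) ≤ (3 * L) * (L * u) := by gcongr; linarith
  linarith

/-! ### Error propagation over the stages -/

lemma lambdaMax_pos {p : ℕ} {A : Matrix (Fin p) (Fin p) ℝ} (hA : A.PosDef) (i : Fin p) :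
    0 < lambdaMax A := by
  have h1 := (posSemidef_lambdaMax_smul_one_sub hA.isHermitian).diag_nonneg (i := i)
  have h2 := hA.diag_pos (i := i)
  simp only [Matrix.sub_apply, Matrix.smul_apply, Matrix.one_apply_eq, smul_eq_mul, mul_one] at h1
  linarith

lemma PrecisionAssumption.sqrt_card_support_le {p s : ℕ} {Theta : Matrix (Fin p) (Fin p) ℝ}
    {lam γ : ℝ} (hprec : PrecisionAssumption Theta s lam γ) :
    √(Finset.card {q : Fin p × Fin p | Theta q.1 q.2 ≠ 0}) ≤ √s := by
  have := hprec.sparse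
  rw [Set.ncard_eq_toFinset_card'] at this
  exact Real.sqrt_le_sqrt (by exact_mod_cast (by simpa using this))

/-- The constant weight `lam` of the first stage exceeds the noise, so only the support of `Theta`
contributes to the error. -/
lemma norm_first_stage_le {p s : ℕ} {S : Set (Matrix (Fin p) (Fin p) ℝ)}
    (hS : S = MMatrices p ∨ S = DDMMatrices p) {Shat Theta A : Matrix (Fin p) (Fin p) ℝ}
    (hTheta : Theta ∈ S) (hL : 0 < lambdaMax Theta) {lam γ : ℝ} (hlam : 0 < lam)
    (hprec : PrecisionAssumption Theta s lam γ)
    (hs : lambdaMax Theta * (lam * √s) ≤ 1 / 9)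
    (hdev : ∀ i j, |(Theta⁻¹ - Shat) i j| ≤ √2 / 2 * lam)
    (hA : IsStageSolution S Shat (fun _ _ => lam) A) :
    ‖A - Theta‖ ≤ lambdaMax Theta ∧
      ‖A - Theta‖ ≤ 6 * lambdaMax Theta ^ 2 * (lam * √s) := by
  classical
  set L := lambdaMax Theta
  have hsqrt : √2 / 2 ≤ 1 := by
    have : √2 ≤ 2 := Real.sqrt_le_iff.2 (by norm_num)
    linarith
  set F : Finset (Fin p × Fin p) := {q | Theta q.1 q.2 ≠ 0} with hF
  have hFs : √F.card ≤ √s := hprec.sqrt_card_support_le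
  have key := norm_sub_le_of_isStageSolution hS hTheta hA hL (lam := lam) (F := F) (G := F) ?_
    hlam.le ?_
  · refine ⟨key.1, key.2.trans ?_⟩
    have : 3 * L ^ 2 * (lam * (√F.card + √F.card)) ≤ 3 * L ^ 2 * (lam * (√s + √s)) := by gcongr
    linarith
  · intro i j
    have hd : |(Theta⁻¹ - Shat) j i| ≤ lam :=
      (hdev j i).trans (mul_le_of_le_one_left hlam.le hsqrt)
    have hD : (A - Theta) i j = A i j - Theta i j := rfl
    by_cases hT : Theta i j = 0
    · have hij : i ≠ j := by
        rintro rfl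
        exact ((posDef_of_mem hS hTheta).diag_pos (i := i)).ne' hT
      have hA0 := offDiag_nonpos_of_mem hS hA.1 hij
      have h0 : (A - Theta) i j ≤ 0 := by rw [hD, hT]; linarith
      have : (i, j) ∉ F := by simp [hF, hT]
      simp only [this, hij, if_false, add_zero, zero_mul, mul_zero]
      exact mul_nonpos_of_nonneg_of_nonpos (by linarith [(abs_le.1 hd).1]) h0
    · have : (i, j) ∈ F := by simp [hF, hT]
      simp only [this, if_true, ← mul_assoc]
      refine (le_abs_self _).trans ?_
      rw [abs_mul]
      gcongr
      refine (abs_add_le _ _).trans ?_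
      have : |if i = j then 0 else lam| ≤ lam := by
        split_ifs
        · simpa using hlam.le
        · exact (abs_of_pos hlam).le
      linarith
  · have : L * (lam * (√F.card + √F.card)) ≤ L * (lam * (√s + √s)) := by gcongr
    linarith

/-- One adaptive stage is a contraction up to the oracle error.  An entry on which the updated
weight is misspecified, that is, too small off the support or positive on it, carries an error above
`c₀ lam` in the previous estimate `B`, so the number of such entries is at most
`(‖B - Theta‖ / (c₀ lam))²`. -/
lemma norm_next_stage_le {p s : ℕ} {S : Set (Matrix (Fin p) (Fin p) ℝ)}
    (hS : S = MMatrices p ∨ S = DDMMatrices p) {Shat Theta A B : Matrix (Fin p) (Fin p) ℝ}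
    (hTheta : Theta ∈ S) (hL : 0 < lambdaMax Theta) {lam γ : ℝ} (hlam : 0 < lam) {w : ℝ → ℝ}
    (hw : WeightAssumption Theta lam γ w) (hprec : PrecisionAssumption Theta s lam γ)
    (hs : lambdaMax Theta * (lam * √s) ≤ 1 / 9)
    (hdev : ∀ i j, |(Theta⁻¹ - Shat) i j| ≤ √2 / 2 * lam)
    (hA : IsStageSolution S Shat (fun i j => w |B i j|) A)
    (hB : ‖B - Theta‖ ≤ lambdaMax Theta) :
    ‖A - Theta‖ ≤ lambdaMax Theta ∧
      ‖A - Theta‖ ≤ 3 * lambdaMax Theta ^ 2 * (lam * √s) + ‖B - Theta‖ / 4 := by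
  classical
  set L := lambdaMax Theta with hLdef
  have hsqrt : √2 / 2 ≤ 1 := by
    have : √2 ≤ 2 := Real.sqrt_le_iff.2 (by norm_num)
    linarith
  set F : Finset (Fin p × Fin p) := {q | Theta q.1 q.2 ≠ 0} with hF
  set G : Finset (Fin p × Fin p) := {q | c0 Theta * lam < |(B - Theta) q.1 q.2|} with hG
  have hmemG : ∀ q, q ∈ G ↔ c0 Theta * lam < |(B - Theta) q.1 q.2| := fun q => by
    rw [hG, Finset.mem_filter_univ]
  have hc0 : c0 Theta = 12 * L ^ 2 := rfl
  have hc0pos : 0 < c0 Theta * lam := by rw [hc0]; positivity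
  have hFs : √F.card ≤ √s := hprec.sqrt_card_support_le
  have hGs : c0 Theta * lam * √G.card ≤ ‖B - Theta‖ := by
    refine abs_le_of_sq_le_sq' ?_ (norm_nonneg _) |>.2
    rw [mul_pow, Real.sq_sqrt (by positivity), frobenius_norm_sq,
      ← Fintype.sum_prod_type' (f := fun i j => (B - Theta) i j ^ 2)]
    calc (c0 Theta * lam) ^ 2 * G.card = ∑ _q ∈ G, (c0 Theta * lam) ^ 2 := by
          rw [Finset.sum_const, nsmul_eq_mul, mul_comm]
      _ ≤ ∑ q ∈ G, (B - Theta) q.1 q.2 ^ 2 := by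
          refine Finset.sum_le_sum fun q hq => ?_
          rw [← sq_abs ((B - Theta) q.1 q.2)]
          have : c0 Theta * lam < |(B - Theta) q.1 q.2| := (hmemG q).1 hq
          gcongr
      _ ≤ _ := Finset.sum_le_sum_of_subset_of_nonneg (Finset.subset_univ _)
          fun _ _ _ => sq_nonneg _
  rw [hc0] at hGs
  have hGL : 12 * (L * (lam * √G.card)) ≤ 1 := by
    have h1 : L * (12 * (L * (lam * √G.card))) ≤ L * 1 := by linarith
    exact le_of_mul_le_mul_left h1 hL
  have hFL : L * (lam * √F.card) ≤ L * (lam * √s) := by gcongr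
  have key := norm_sub_le_of_isStageSolution hS hTheta hA hL (lam := lam) (F := F) (G := G) ?_
    hlam.le ?_
  · refine ⟨key.1, key.2.trans ?_⟩
    have : L * (L * (lam * √F.card)) ≤ L * (L * (lam * √s)) := by gcongr
    linarith
  · intro i j
    have hd' := hdev j i
    have hd : |(Theta⁻¹ - Shat) j i| ≤ lam := hd'.trans (mul_le_of_le_one_left hlam.le hsqrt)
    have hD : (A - Theta) i j = A i j - Theta i j := rfl
    have hwnn : 0 ≤ w |B i j| := hw.nonneg _ (abs_nonneg _)
    have hwle : w |B i j| ≤ lam := by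
      rw [← hw.at_zero]
      exact hw.antitone (Set.mem_Ici.2 le_rfl) (Set.mem_Ici.2 (abs_nonneg _)) (abs_nonneg _)
    by_cases hT : Theta i j = 0
    · have hij : i ≠ j := by
        rintro rfl
        exact ((posDef_of_mem hS hTheta).diag_pos (i := i)).ne' hT
      have hA0 := offDiag_nonpos_of_mem hS hA.1 hij
      have h0 : (A - Theta) i j ≤ 0 := by rw [hD, hT]; linarith
      have hmF : (i, j) ∉ F := by simp [hF, hT]
      by_cases hmG : (i, j) ∈ G
      · simp only [hmF, hmG, hij, if_false, if_true, zero_add, one_mul]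
        rw [abs_of_nonpos h0]
        nlinarith [(abs_le.1 hd).1]
      · simp only [hmF, hmG, hij, if_false, add_zero, zero_mul, mul_zero]
        have hsmall : |B i j| ≤ c0 Theta * lam := by simpa [hmemG, hT] using hmG
        have hwge : √2 / 2 * lam ≤ w |B i j| := hw.lower.trans
          (hw.antitone (Set.mem_Ici.2 (abs_nonneg _)) (Set.mem_Ici.2 hc0pos.le) hsmall)
        exact mul_nonpos_of_nonneg_of_nonpos (by linarith [(abs_le.1 hd').1]) h0
    · have hmF : (i, j) ∈ F := by simp [hF, hT]
      refine (le_abs_self _).trans ?_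
      rw [abs_mul, ← mul_assoc]
      refine mul_le_mul_of_nonneg_right ((abs_add_le _ _).trans ?_) (abs_nonneg _)
      by_cases hmG : (i, j) ∈ G
      · simp only [hmF, hmG, if_true]
        have : abs (if i = j then 0 else w |B i j|) ≤ lam := by
          split_ifs
          · simpa using hlam.le
          · rwa [abs_of_nonneg hwnn]
        linarith
      · simp only [hmF, hmG, if_true, if_false]
        have : (if i = j then 0 else w |B i j|) = 0 := by
          split_ifs with hij
          · rfl
          · -- a strong signal that is estimated within `c₀ lam` is no longer penalized
            refine hw.eq_zero _ ?_
            have h1 := hprec.signal i j hij hT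
            have h2 : |B i j - Theta i j| ≤ c0 Theta * lam := by simpa [hmemG] using hmG
            have h3 := abs_sub_abs_le_abs_sub (Theta i j) (B i j)
            rw [abs_sub_comm] at h3
            linarith
        rw [this, abs_zero]
        linarith
  · linarith

theorem norm_adaptiveSequence_le {p s : ℕ} {S : Set (Matrix (Fin p) (Fin p) ℝ)}
    (hS : S = MMatrices p ∨ S = DDMMatrices p) {Shat Theta : Matrix (Fin p) (Fin p) ℝ}
    (hTheta : Theta ∈ S) (hL : 0 < lambdaMax Theta) {lam γ : ℝ} (hlam : 0 < lam) {w : ℝ → ℝ}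
    (hw : WeightAssumption Theta lam γ w) (hprec : PrecisionAssumption Theta s lam γ)
    (hs : lambdaMax Theta * (lam * √s) ≤ 1 / 9)
    (hdev : ∀ i j, |(Theta⁻¹ - Shat) i j| ≤ √2 / 2 * lam)
    {A : ℕ → Matrix (Fin p) (Fin p) ℝ} (hA : IsAdaptiveSequence S Shat lam w A)
    {k : ℕ} (hk : 1 ≤ k) :
    ‖A k - Theta‖ ≤ lambdaMax Theta ∧
      ‖A k - Theta‖ ≤ 6 * lambdaMax Theta ^ 2 * (lam * √s) := by
  induction k, hk using Nat.le_induction with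
  | base => exact norm_first_stage_le hS hTheta hL hlam hprec hs hdev hA.first
  | succ k hk ih =>
    have h := norm_next_stage_le hS hTheta hL hlam hw hprec hs hdev (hA.next k hk) ih.1
    refine ⟨h.1, h.2.trans ?_⟩
    have : 0 ≤ lambdaMax Theta ^ 2 * (lam * √s) := by positivity
    linarith [ih.2]

/-! ### Concentration of the sample covariance matrix -/

lemma mgf_sq_gaussianReal {v : NNReal} {θ : ℝ} (h : 2 * θ * v < 1) :
    mgf (fun x => x ^ 2) (gaussianReal 0 v) θ = (√(1 - 2 * θ * v))⁻¹ := by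
  rw [mgf]
  by_cases hv : v = 0
  · simp [hv]
  have hv0 : (0 : ℝ) < v := NNReal.coe_pos.2 (pos_iff_ne_zero.2 hv)
  have hfun : (fun x : ℝ => gaussianPDFReal 0 v x • Real.exp (θ * x ^ 2)) =
      fun x => (√(2 * Real.pi * v))⁻¹ * Real.exp (-((1 - 2 * θ * v) / (2 * v)) * x ^ 2) := by
    funext x
    rw [gaussianPDFReal, smul_eq_mul, mul_assoc, ← Real.exp_add]
    congr 2
    field_simp
    ring
  have hb : 0 < 1 - 2 * θ * v := by linarith
  rw [integral_gaussianReal_eq_integral_smul hv, hfun, integral_const_mul, integral_gaussian,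
    ← Real.sqrt_inv, ← Real.sqrt_inv, ← Real.sqrt_mul (by positivity)]
  congr 1
  have := Real.pi_pos
  field_simp

lemma mgf_sq_gaussianReal_le {v : NNReal} {θ : ℝ} (h : |θ * v| ≤ 1 / 10) :
    mgf (fun x => x ^ 2) (gaussianReal 0 v) θ ≤ Real.exp (θ * v + 4 * (θ * v) ^ 2) := by
  obtain ⟨h1, h2⟩ := abs_le.1 h
  rw [mgf_sq_gaussianReal (by linarith), mul_assoc]
  set t := θ * v
  -- after squaring, the claim is `exp (-(2 t + 8 t²)) ≤ 1 - 2 t`, by Taylor expansion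
  have hz : |-(2 * t + 8 * t ^ 2)| ≤ 1 := by
    rw [abs_le]; constructor <;> nlinarith
  have h3 := (abs_le.1 (Real.abs_exp_sub_one_sub_id_le hz)).2
  have h4 : Real.exp (-(2 * t + 8 * t ^ 2)) ≤ 1 - 2 * t := by
    have : (2 + 8 * t) ^ 2 ≤ 8 := by nlinarith
    nlinarith [mul_le_mul_of_nonneg_left this (sq_nonneg t)]
  have h5 : Real.exp (-(t + 4 * t ^ 2)) ≤ √(1 - 2 * t) := by
    refine Real.le_sqrt_of_sq_le ?_
    rw [← Real.exp_nat_mul]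
    convert h4 using 2
    push_cast; ring
  rw [← neg_neg (t + 4 * t ^ 2), Real.exp_neg]
  exact inv_anti₀ (Real.exp_pos _) h5

/-- Chernoff bound for the sum of squares of independent centred Gaussian variables. -/
lemma measure_abs_sum_sq_sub_ge_le {n : ℕ} {Ω : Type*} [MeasurableSpace Ω] {P : Measure Ω}
    [IsProbabilityMeasure P] {Z : Fin n → Ω → ℝ} {v : NNReal} (hindep : iIndepFun Z P)
    (hlaw : ∀ k, HasLaw (Z k) (gaussianReal 0 v) P) {θ : ℝ} (hθ : 0 ≤ θ) (hθv : θ * v ≤ 1 / 10)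
    (r : ℝ) :
    P.real {ω | r ≤ |∑ k, Z k ω ^ 2 - n * v|} ≤
      2 * Real.exp (-θ * r + n * (4 * (θ * v) ^ 2)) := by
  have hYindep : iIndepFun (fun k ω => Z k ω ^ 2) P :=
    hindep.comp (fun _ x => x ^ 2) fun _ => by fun_prop
  have hYmeas : ∀ k, AEMeasurable (fun ω => Z k ω ^ 2) P := fun k =>
    (hlaw k).aemeasurable.pow_const 2
  have hmgf : ∀ t : ℝ, mgf (∑ k, fun ω => Z k ω ^ 2) P t =
      mgf (fun x => x ^ 2) (gaussianReal 0 v) t ^ n := fun t => by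
    rw [hYindep.mgf_sum₀ hYmeas]
    have : ∀ k, mgf (fun ω => Z k ω ^ 2) P t = mgf (fun x => x ^ 2) (gaussianReal 0 v) t :=
      fun k => (hlaw k).integral_comp (f := fun x => Real.exp (t * x ^ 2)) (by fun_prop)
    simp [this]
  have hv : (0 : ℝ) ≤ v := v.2
  have hbound : ∀ t : ℝ, |t * v| ≤ 1 / 10 →
      Integrable (fun ω => Real.exp (t * (∑ k, fun ω => Z k ω ^ 2) ω)) P ∧
      mgf (∑ k, fun ω => Z k ω ^ 2) P t ≤ Real.exp (n * (t * v + 4 * (t * v) ^ 2)) := by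
    intro t ht
    constructor
    · -- the integral is nonzero, hence not a junk value
      by_contra hint
      have h0 := (hmgf t).symm.trans (integral_undef hint)
      have h1 : 0 < 1 - 2 * t * v := by linarith [(abs_le.1 ht).2]
      rw [mgf_sq_gaussianReal (by linarith)] at h0
      have : 0 < (√(1 - 2 * t * v))⁻¹ ^ n := by positivity
      exact this.ne' h0
    · rw [hmgf, Real.exp_nat_mul]
      exact pow_le_pow_left₀ mgf_nonneg (mgf_sq_gaussianReal_le ht) n
  have hθabs : |θ * v| ≤ 1 / 10 := by rwa [abs_of_nonneg (by positivity)]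
  have hup := hbound θ hθabs
  have hlo := hbound (-θ) (by rwa [neg_mul, abs_neg])
  have h1 := measure_ge_le_exp_mul_mgf (n * v + r) hθ hup.1
  have h2 := measure_le_le_exp_mul_mgf (n * v - r) (neg_nonpos.2 hθ) hlo.1
  have h3 : Real.exp (-θ * (n * v + r)) * mgf (∑ k, fun ω => Z k ω ^ 2) P θ ≤
      Real.exp (-θ * r + n * (4 * (θ * v) ^ 2)) := by
    refine (mul_le_mul_of_nonneg_left hup.2 (Real.exp_pos _).le).trans_eq ?_
    rw [← Real.exp_add]; congr 1; ring
  have h4 : Real.exp (-(-θ) * (n * v - r)) * mgf (∑ k, fun ω => Z k ω ^ 2) P (-θ) ≤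
      Real.exp (-θ * r + n * (4 * (θ * v) ^ 2)) := by
    refine (mul_le_mul_of_nonneg_left hlo.2 (Real.exp_pos _).le).trans_eq ?_
    rw [← Real.exp_add]; congr 1; ring
  have hsub : {ω | r ≤ |∑ k, Z k ω ^ 2 - n * v|} ⊆
      {ω | n * v + r ≤ (∑ k, fun ω => Z k ω ^ 2) ω} ∪
      {ω | (∑ k, fun ω => Z k ω ^ 2) ω ≤ n * v - r} := by
    intro ω hω
    simp only [Set.mem_union, Set.mem_ofPred_eq, Finset.sum_apply] at hω ⊢
    rcases le_abs.1 hω with h | h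
    · left; linarith
    · right; linarith
  calc _ ≤ _ := measureReal_mono hsub
    _ ≤ _ := measureReal_union_le _ _
    _ ≤ _ := by linarith

/-- Each linear functional of a centred multivariate Gaussian vector is a centred Gaussian
variable. -/
lemma hasLaw_inner_multivariateGaussian {ι : Type*} [Fintype ι] [DecidableEq ι]
    {S : Matrix ι ι ℝ} (hS : S.PosSemidef) (u : EuclideanSpace ℝ ι) :
    HasLaw (fun x => inner ℝ u x) (gaussianReal 0 (u.ofLp ⬝ᵥ S *ᵥ u.ofLp).toNNReal)
      (multivariateGaussian 0 S) where
  map_eq := by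
    have h1 := IsGaussian.map_eq_gaussianReal (μ := multivariateGaussian 0 S) (innerSL ℝ u)
    have h2 := covarianceBilin_self (μ := multivariateGaussian 0 S) IsGaussian.memLp_two_id u
    rw [covarianceBilin_multivariateGaussian hS] at h2
    have h3 : ∫ x, innerSL ℝ u x ∂(multivariateGaussian 0 S) = 0 :=
      ((innerSL ℝ u).integral_comp_comm IsGaussian.integrable_fun_id).trans (by simp)
    rw [h3] at h1
    rw [h2]
    exact h1

/-- The deviation of an entry of the sample covariance matrix.  By polarization it is a combination
of the deviations of the sums of squares of `x_i + x_j` and of `x_i - x_j`. -/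
lemma measure_abs_sampleCov_sub_ge_le {n p : ℕ} (hn : n ≠ 0) {Ω : Type*} [MeasurableSpace Ω]
    {P : Measure Ω} [IsProbabilityMeasure P] {S : Matrix (Fin p) (Fin p) ℝ} (hS : S.PosSemidef)
    {X : Fin n → Ω → EuclideanSpace ℝ (Fin p)}
    (hlaw : ∀ k, HasLaw (X k) (multivariateGaussian 0 S) P) (hindep : iIndepFun X P)
    {K ε : ℝ} (hK : 0 < K) (hSK : ∀ i, S i i ≤ K) (hε : 0 ≤ ε) (hε' : ε ≤ 1 / 10)
    (i j : Fin p) :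
    P.real {ω | 10 * K * ε ≤ |(S - sampleCov fun k => X k ω) i j|} ≤
      4 * Real.exp (-(n * ε ^ 2)) := by
  have hn0 : (0 : ℝ) < n := by exact_mod_cast hn.bot_lt
  have hSij : S i j = S j i := by simpa using (hS.isHermitian.apply i j).symm
  -- the variance of `x_i + σ x_j`
  let u : ℝ → EuclideanSpace ℝ (Fin p) := fun σ =>
    EuclideanSpace.single i 1 + σ • EuclideanSpace.single j 1
  let v : ℝ → ℝ := fun σ => (u σ).ofLp ⬝ᵥ S *ᵥ (u σ).ofLp
  let Z : ℝ → Fin n → Ω → ℝ := fun σ k ω => inner ℝ (u σ) (X k ω)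
  have hZ : ∀ σ k ω, Z σ k ω = X k ω i + σ * X k ω j := fun σ k ω => by
    simp [Z, u, inner_add_left, inner_smul_left, EuclideanSpace.inner_single_left]
  have hv : ∀ σ, v σ = S i i + σ * (2 * S i j) + σ ^ 2 * S j j := fun σ => by
    simp only [v, u, WithLp.ofLp_add, WithLp.ofLp_smul, PiLp.ofLp_single, mulVec_add,
      mulVec_smul, dotProduct_add, add_dotProduct, smul_dotProduct, dotProduct_smul,
      mulVec_single_one, single_one_dotProduct, smul_eq_mul, col_apply]
    rw [hSij]; ring
  have hv0 : ∀ σ, 0 ≤ v σ := fun σ => by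
    simpa using hS.dotProduct_mulVec_nonneg (u σ).ofLp
  have hv1 : v 1 ≤ 4 * K := by
    have := hv0 (-1)
    rw [hv] at this ⊢
    linarith [hSK i, hSK j]
  have hv2 : v (-1) ≤ 4 * K := by
    have := hv0 1
    rw [hv] at this ⊢
    linarith [hSK i, hSK j]
  have htail : ∀ σ, v σ ≤ 4 * K →
      P.real {ω | n * (20 * K * ε) ≤ |∑ k, Z σ k ω ^ 2 - n * v σ|} ≤
        2 * Real.exp (-(n * ε ^ 2)) := by
    intro σ hσ
    have hZindep : iIndepFun (Z σ) P :=
      hindep.comp (fun _ x => inner ℝ (u σ) x) fun _ => by fun_prop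
    have hZlaw : ∀ k, HasLaw (Z σ k) (gaussianReal 0 (v σ).toNNReal) P := fun k =>
      (hasLaw_inner_multivariateGaussian hS (u σ)).fun_comp (hlaw k)
    -- the Chernoff parameter `ε / (4 K)` makes the two terms of the exponent of order `n ε²`
    have hθv : ε / (4 * K) * v σ ≤ ε := by
      rw [div_mul_eq_mul_div, div_le_iff₀ (by positivity)]
      gcongr
    have h := measure_abs_sum_sq_sub_ge_le hZindep hZlaw (θ := ε / (4 * K)) (by positivity)
      (by rw [Real.coe_toNNReal _ (hv0 σ)]; linarith) (n * (20 * K * ε))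
    rw [Real.coe_toNNReal _ (hv0 σ)] at h
    refine h.trans ?_
    gcongr
    have h1 : -(ε / (4 * K)) * (n * (20 * K * ε)) = -(5 * (n * ε ^ 2)) := by
      field_simp; ring
    have h2 : n * (4 * (ε / (4 * K) * v σ) ^ 2) ≤ n * (4 * ε ^ 2) := by
      have := hv0 σ
      gcongr
    rw [h1]
    linarith
  have hsub : {ω | 10 * K * ε ≤ |(S - sampleCov fun k => X k ω) i j|} ⊆
      {ω | n * (20 * K * ε) ≤ |∑ k, Z 1 k ω ^ 2 - n * v 1|} ∪
      {ω | n * (20 * K * ε) ≤ |∑ k, Z (-1) k ω ^ 2 - n * v (-1)|} := by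
    intro ω hω
    by_contra hcon
    simp only [Set.mem_union, Set.mem_ofPred_eq, not_or, not_le] at hω hcon
    have hpol : (∑ k, Z 1 k ω ^ 2 - n * v 1) - (∑ k, Z (-1) k ω ^ 2 - n * v (-1)) =
        -(4 * (n * (S - sampleCov fun k => X k ω) i j)) := by
      have hcov : n * (S - sampleCov fun k => X k ω) i j = n * S i j - ∑ k, X k ω i * X k ω j := by
        rw [Matrix.sub_apply, sampleCov, Matrix.smul_apply, Matrix.sum_apply]
        simp only [vecMulVec_apply, smul_eq_mul]
        field_simp
      have hsq : ∑ k, Z 1 k ω ^ 2 - ∑ k, Z (-1) k ω ^ 2 = 4 * ∑ k, X k ω i * X k ω j := by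
        rw [← Finset.sum_sub_distrib, Finset.mul_sum]
        refine Finset.sum_congr rfl fun k _ => ?_
        rw [hZ, hZ]; ring
      rw [hcov, hv, hv]
      linarith
    have h4 : |4 * (n * (S - sampleCov fun k => X k ω) i j)| < 2 * (n * (20 * K * ε)) := by
      rw [← abs_neg, ← hpol]
      exact (abs_sub _ _).trans_lt (by linarith [hcon.1, hcon.2])
    rw [abs_mul, abs_mul, abs_of_pos hn0, abs_of_pos (by norm_num : (0 : ℝ) < 4)] at h4
    have h5 : n * (10 * K * ε) ≤ n * |(S - sampleCov fun k => X k ω) i j| := by gcongr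
    linarith
  calc _ ≤ _ := measureReal_mono hsub
    _ ≤ _ := measureReal_union_le _ _
    _ ≤ _ := by linarith [htail 1 hv1, htail (-1) hv2]

/-- For `A` a precision matrix, this bounds `L⁻¹` by every variance, which makes the
deviation parameter in the concentration inequality small. -/
lemma inv_lambdaMax_le_inv_diag {p : ℕ} {A : Matrix (Fin p) (Fin p) ℝ} (hA : A.PosDef)
    (i : Fin p) : (lambdaMax A)⁻¹ ≤ A⁻¹ i i := by
  have h := (posSemidef_inv_sub hA (lambdaMax_pos hA i)
    (posSemidef_lambdaMax_smul_one_sub hA.isHermitian)).diag_nonneg (i := i)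
  simp only [Matrix.sub_apply, Matrix.smul_apply, Matrix.one_apply_eq, smul_eq_mul, mul_one] at h
  linarith

/-- Union bound over the entries of the sample covariance matrix. -/
lemma measure_iUnion_sampleCov_le {n p : ℕ} (hn : n ≠ 0) (hp : p ≠ 0) {Ω : Type*}
    [MeasurableSpace Ω] {P : Measure Ω} [IsProbabilityMeasure P] {S : Matrix (Fin p) (Fin p) ℝ}
    (hS : S.PosSemidef) {X : Fin n → Ω → EuclideanSpace ℝ (Fin p)}
    (hlaw : ∀ k, HasLaw (X k) (multivariateGaussian 0 S) P) (hindep : iIndepFun X P)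
    {K ε τ : ℝ} (hK : 0 < K) (hSK : ∀ i, S i i ≤ K) (hε : 0 ≤ ε) (hε' : ε ≤ 1 / 10)
    (hτ : n * ε ^ 2 = τ * Real.log p) :
    P.real (⋃ q : Fin p × Fin p,
      {ω | 10 * K * ε ≤ |(S - sampleCov fun k => X k ω) q.1 q.2|}) ≤ 4 / (p : ℝ) ^ (τ - 2) := by
  have hp0 : (0 : ℝ) < p := by exact_mod_cast hp.bot_lt
  refine (measureReal_iUnion_fintype_le _).trans ((Finset.sum_le_sum fun q _ =>
    measure_abs_sampleCov_sub_ge_le hn hS hlaw hindep hK hSK hε hε' q.1 q.2).trans_eq ?_)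
  have hexp : Real.exp (-(n * ε ^ 2)) = ((p : ℝ) ^ τ)⁻¹ := by
    rw [hτ, Real.exp_neg, mul_comm, Real.rpow_def_of_pos hp0]
  have : (p : ℝ) ^ τ ≠ 0 := (Real.rpow_pos_of_pos hp0 τ).ne'
  rw [hexp, Finset.sum_const, Finset.card_univ, Fintype.card_prod, Fintype.card_fin, nsmul_eq_mul,
    Real.rpow_sub hp0, Real.rpow_two]
  push_cast
  field_simp

end MTP2

/-! ### The error bound for the adaptive estimates -/

theorem corollary1
    {p n s : ℕ} (hp : 1 ≤ p)
    -- the feasible set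
    (S : Set (Matrix (Fin p) (Fin p) ℝ)) (hS : S = MTP2.MMatrices p ∨ S = MTP2.DDMMatrices p)
    -- the underlying covariance and precision matrices
    (Sigma Theta : Matrix (Fin p) (Fin p) ℝ) (hSigma : Sigma.PosDef)
    (hTheta : Theta = Sigma⁻¹) (hThetaS : Theta ∈ S)
    -- the regularization parameter, the two assumptions and the sample size
    (τ lam γ : ℝ) (hτ : 2 < τ) (w : ℝ → ℝ)
    (hlam : lam = √(MTP2.c1 Sigma * τ * Real.log p / n))
    (hw : MTP2.WeightAssumption Theta lam γ w)
    (hprec : MTP2.PrecisionAssumption Theta s lam γ)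
    (hn : 8 * MTP2.c0 Theta * MTP2.c1 Sigma * τ * s * Real.log p ≤ n)
    -- the observations
    {Ω : Type*} [MeasurableSpace Ω] (P : Measure Ω) [IsProbabilityMeasure P]
    (X : Fin n → Ω → EuclideanSpace ℝ (Fin p))
    (hlaw : ∀ i, HasLaw (X i) (multivariateGaussian 0 Sigma) P)
    (hindep : iIndepFun X P)
    -- the estimates
    (Thetahat : ℕ → Ω → Matrix (Fin p) (Fin p) ℝ)
    (hest : ∀ᵐ ω ∂P, MTP2.IsAdaptiveSequence S (MTP2.sampleCov fun i => X i ω) lam w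
      fun k => Thetahat k ω) :
    ∃ E : Set Ω, MeasurableSet E ∧ 1 - 4 / (p : ℝ) ^ (τ - 2) ≤ P.real E ∧
      ∀ ω ∈ E, ∀ k : ℕ,
        ‖Thetahat k ω - Theta‖ ≤
          2 * MTP2.c0 Theta * √(2 * MTP2.c1 Sigma * τ) * √(s * Real.log p / n)
            + ((2 + √2) / 4) ^ k * ‖Thetahat 0 ω - Theta‖ := by
  -- for `p = 1` the lower bound `1 - 4` is negative
  rcases hp.eq_or_lt with rfl | hp2
  · exact ⟨∅, .empty, by norm_num, by simp⟩
  have hp0 : p ≠ 0 := by omega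
  have hlog : 0 < Real.log p := Real.log_pos (by exact_mod_cast hp2)
  have hτ0 : 0 < τ := by linarith
  have hThetaPos : Theta.PosDef := hTheta ▸ hSigma.inv
  have hinv : Theta⁻¹ = Sigma := by
    rw [hTheta, Matrix.nonsing_inv_nonsing_inv _
      ((Matrix.isUnit_iff_isUnit_det Sigma).1 hSigma.isUnit)]
  set i₀ : Fin p := ⟨0, by omega⟩
  set L := MTP2.lambdaMax Theta with hLdef
  have hL : 0 < L := MTP2.lambdaMax_pos hThetaPos i₀
  set K := ⨆ i, Sigma i i with hKdef
  have hSK : ∀ i, Sigma i i ≤ K := fun i =>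
    le_ciSup (f := fun i => Sigma i i) (Set.finite_range _).bddAbove i
  have hLK : L⁻¹ ≤ K := (hinv ▸ MTP2.inv_lambdaMax_le_inv_diag hThetaPos i₀).trans (hSK i₀)
  have hK : 0 < K := (inv_pos.2 hL).trans_le hLK
  have hc0 : MTP2.c0 Theta = 12 * L ^ 2 := rfl
  have hc1 : MTP2.c1 Sigma = (80 * K) ^ 2 := rfl
  have hs1 : (1 : ℝ) ≤ s := by
    have hmem : (i₀, i₀) ∈ {ij : Fin p × Fin p | Theta ij.1 ij.2 ≠ 0} :=
      (hThetaPos.diag_pos (i := i₀)).ne'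
    exact_mod_cast (Set.ncard_pos (Set.toFinite _)).2 ⟨_, hmem⟩ |>.trans_le hprec.sparse
  rw [hc0, hc1] at hn
  have hn0 : (0 : ℝ) < n := lt_of_lt_of_le (by positivity) hn
  set ε := √(τ * Real.log p / n) with hεdef
  have hε : 0 < ε := Real.sqrt_pos.2 (by positivity)
  have hε2 : n * ε ^ 2 = τ * Real.log p := by
    rw [hεdef, Real.sq_sqrt (by positivity)]
    field_simp
  have hlamε : lam = 80 * K * ε := by
    rw [hlam, hc1, mul_assoc, mul_div_assoc, Real.sqrt_mul (by positivity),
      Real.sqrt_sq (by positivity)]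
  have hlampos : 0 < lam := by rw [hlamε]; positivity
  have hs : L * (lam * √s) ≤ 1 / 9 := by
    refine abs_le_of_sq_le_sq' ?_ (by norm_num) |>.2
    rw [mul_pow, mul_pow, Real.sq_sqrt (by positivity), hlamε]
    have h1 : n * (96 * (L ^ 2 * ((80 * K * ε) ^ 2 * s))) ≤ n * 1 := by
      calc n * (96 * (L ^ 2 * ((80 * K * ε) ^ 2 * s)))
          = 96 * L ^ 2 * (80 * K) ^ 2 * s * (n * ε ^ 2) := by ring
        _ = 8 * (12 * L ^ 2) * (80 * K) ^ 2 * τ * s * Real.log p := by rw [hε2]; ring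
        _ ≤ n * 1 := by linarith
    have h2 := le_of_mul_le_mul_left h1 hn0
    norm_num
    linarith
  have hεsmall : ε ≤ 1 / 10 := by
    have h1 : 1 ≤ √(s : ℝ) := Real.one_le_sqrt.2 hs1
    have h2 : 1 ≤ L * K := by rwa [inv_le_iff_one_le_mul₀' hL] at hLK
    have h3 : L * (lam * 1) ≤ L * (lam * √s) := by gcongr
    have h4 : ε * 1 ≤ ε * (L * K) := by gcongr
    rw [hlamε] at h3 hs
    linarith
  have hthreshold : 10 * K * ε ≤ √2 / 2 * lam := by
    have h1 : 1 ≤ √(2 : ℝ) := Real.one_le_sqrt.2 (by norm_num)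
    have h2 : 1 * (K * ε) ≤ √2 * (K * ε) := by gcongr
    rw [hlamε]
    linarith [mul_pos hK hε]
  set bad : Set Ω := ⋃ q : Fin p × Fin p,
    {ω | 10 * K * ε ≤ |(Sigma - MTP2.sampleCov fun k => X k ω) q.1 q.2|} with hbad
  have hbadP : P.real bad ≤ 4 / (p : ℝ) ^ (τ - 2) :=
    MTP2.measure_iUnion_sampleCov_le (by exact_mod_cast hn0.ne') hp0 hSigma.posSemidef hlaw hindep
      hK hSK hε.le hεsmall hε2
  set null : Set Ω := {ω | ¬ MTP2.IsAdaptiveSequence S (MTP2.sampleCov fun i => X i ω) lam w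
      fun k => Thetahat k ω} with hnull
  have hnullP : P null = 0 := ae_iff.1 hest
  -- the estimates are not assumed measurable, hence the measurable hull
  refine ⟨(toMeasurable P (bad ∪ null))ᶜ, (measurableSet_toMeasurable _ _).compl, ?_, ?_⟩
  · rw [probReal_compl_eq_one_sub (measurableSet_toMeasurable _ _), measureReal_def,
      measure_toMeasurable, ← measureReal_def]
    have hnullR : P.real null = 0 := by rw [measureReal_def, hnullP, ENNReal.toReal_zero]
    linarith [measureReal_union_le (μ := P) bad null]
  · intro ω hω k
    have hω' : ω ∉ bad ∪ null := fun h => hω (subset_toMeasurable _ _ h)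
    rw [Set.mem_union, not_or] at hω'
    have hseq : MTP2.IsAdaptiveSequence S (MTP2.sampleCov fun i => X i ω) lam w
        fun k => Thetahat k ω := not_not.1 hω'.2
    have hdev : ∀ i j, |(Theta⁻¹ - MTP2.sampleCov fun k => X k ω) i j| ≤ √2 / 2 * lam := by
      intro i j
      rw [hinv]
      by_contra! hlt
      exact hω'.1 (Set.mem_iUnion.2 ⟨(i, j), (hthreshold.trans hlt.le)⟩)
    have hrate : 0 ≤ 2 * MTP2.c0 Theta * √(2 * MTP2.c1 Sigma * τ) * √(s * Real.log p / n) := by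
      rw [hc0]; positivity
    rcases Nat.eq_zero_or_pos k with rfl | hk
    · simpa using hrate
    have hmain := (MTP2.norm_adaptiveSequence_le hS hThetaS hL hlampos hw hprec hs hdev hseq hk).2
    refine hmain.trans ?_
    have hprod : √(2 * MTP2.c1 Sigma * τ) * √(s * Real.log p / n) = √2 * (lam * √s) := by
      rw [hlam, ← Real.sqrt_mul (by rw [hc1]; positivity), ← Real.sqrt_mul (by rw [hc1]; positivity),
        ← Real.sqrt_mul (by norm_num)]
      congr 1
      ring
    have h1 : 1 ≤ √(2 : ℝ) := Real.one_le_sqrt.2 (by norm_num)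
    have h2 : 24 * L ^ 2 * (1 * (lam * √s)) ≤ 24 * L ^ 2 * (√2 * (lam * √s)) := by gcongr
    have h3 : 0 ≤ L ^ 2 * (lam * √s) := by positivity
    have h4 : 0 ≤ ((2 + √2) / 4) ^ k * ‖Thetahat 0 ω - Theta‖ := by positivity
    rw [mul_assoc (2 * MTP2.c0 Theta), hprod, hc0]
    linarith
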